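/- Conventions. For a finite set $V_n$, a symmetric set $E_n\subset V_n\times V_n$ containing no diagonal pair, and a family $\{X_v\}$ of i.i.d. standard normal random variables, put $Z_n=\sum_{(v,w)\in E_n}X_vX_w$, so that $\mathbb E[Z_n^2]=2|E_n|$; for $B\subset V_n$ let $\sigma_n^2(B)=2\,|E_n\cap(B\times B)|$. The sequence $\{Z_n\}$ is *reducible* if there are, for every $n$, pairwise disjoint sets $B_1^{(n)},\dots,B_{m_n}^{(n)}\subset V_n$ such that, as $n\to\infty$, $m_n\to\infty$, $\frac1{2|E_n|}\sum_{i\le m_n}\sigma_n^2(B_i^{(n)})\to1$ and $\frac1{2|E_n|}\max_{i\le m_n}\sigma_n^2(B_i^{(n)})\to0$; otherwise it is *irreducible*. A sequence of finite simple graphs $G_n=(V_n,\mathcal E_n)$ *generates an irreducible CLT* if $|V_n|\to\infty$, $|\mathcal E_n|\to\infty$ and, with $E_n=\{(v,w):\{v,w\}\in\mathcal E_n\}$, the sequence $\{Z_n\}$ is irreducible and $Z_n/\sqrt{2|E_n|}$ converges in distribution to $\mathcal N(0,1)$. The $m$-th Cartesian power $G^{\square m}$ of $G=(V,\mathcal E)$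 has vertex set $V^m$, with $v\sim w$ if and only if there is $j$ such that $\{v_j,w_j\}\in\mathcal E$ and $v_i=w_i$ for all $i\ne j$. The normalized Laplacian of $G$ is $I-D^{-1/2}AD^{-1/2}$, with $A$ the adjacency matrix and $D$ the diagonal matrix of the degrees; its eigenvalues, counted with multiplicity, are written $\mu_1\le\mu_2\le\cdots$. Proposition 3.3. Let $G_n^0=(V_n^0,\mathcal E_n^0)$, $n\ge1$, be connected finite simple graphs such that (i) $G_n^0$ is $d_n$-regular for some $d_n\ge1$, (ii) $|V_n^0|\to\infty$, and (iii) $\liminf_{n\to\infty}\mu_2^{(0,n)}>0$, where $\mu_2^{(0,n)}$ is the second smallest eigenvalue of the normalized Laplacian of $G_n^0$. Then, for every fixed integer $m\ge2$, the sequence $G_n=(G_n^0)^{\square m}$ generates an irreducible CLT. In particular, for every fixed $m\ge2$, the sequences $K_n^{\square m}$, $n\ge2$, and $K_{n,n}^{\square m}$, $n\ge1$, where $K_n$ is the complete graph and $K_{n,n}$ the complete bipartite graph, generate an irreducible CLT. -/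

import Mathlib

open MeasureTheory ProbabilityTheory Filter Topology
open scoped Nat

noncomputable section

namespace HomSum

/-! ### Homogeneous sums and irreducibility -/

/-- The squared norm `‖q‖²` of the coefficients `q` on the index set `E`. -/
def coeffNormSq {d : ℕ} {V : Type*} (E : Finset (Fin d → V)) (q : (Fin d → V) → ℝ) : ℝ :=
  ∑ v ∈ E, q v ^ 2

/-- The homogeneous sum `∑_{(v₁,…,v_d) ∈ E} q(v₁,…,v_d) x_{v₁} ⋯ x_{v_d}`. -/
def homogeneousSum {d : ℕ} {V : Type*} (E : Finset (Fin d → V)) (q : (Fin d → V) → ℝ)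
    (x : V → ℝ) : ℝ :=
  ∑ v ∈ E, q v * ∏ i, x (v i)

open scoped Classical in
/-- The contribution `σ²(B)` of the box `B ⊆ V` to the variance of the homogeneous sum. -/
def boxVariance {d : ℕ} {V : Type*} (E : Finset (Fin d → V)) (q : (Fin d → V) → ℝ)
    (B : Finset V) : ℝ :=
  (d ! : ℝ) * ∑ v ∈ E with ∀ i, v i ∈ B, q v ^ 2

/-- Reducibility of the sequence of homogeneous sums with index sets `E n ⊆ (V n)^d` and
coefficients `q n`: there are boxes `B n 0, …, B n (M n - 1) ⊆ V n`, disjoint for every `n`, in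
growing number, which carry asymptotically all the variance while each of them carries
(uniformly) an asymptotically negligible part of it. -/
def IsReducible {d : ℕ} {V : ℕ → Type*} (E : ∀ n, Finset (Fin d → V n))
    (q : ∀ n, (Fin d → V n) → ℝ) : Prop :=
  ∃ (M : ℕ → ℕ) (B : ∀ n, Fin (M n) → Finset (V n)),
    (∀ n i j, i ≠ j → Disjoint (B n i) (B n j)) ∧
    Tendsto M atTop atTop ∧
    Tendsto (fun n => (1 / (d ! * coeffNormSq (E n) (q n))) *
      ∑ i, boxVariance (E n) (q n) (B n i)) atTop (𝓝 1) ∧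
    Tendsto (fun n => (1 / (d ! * coeffNormSq (E n) (q n))) *
      ⨆ i, boxVariance (E n) (q n) (B n i)) atTop (𝓝 0)

def IsIrreducible {d : ℕ} {V : ℕ → Type*} (E : ∀ n, Finset (Fin d → V n))
    (q : ∀ n, (Fin d → V n) → ℝ) : Prop :=
  ¬ IsReducible E q

/-- `x` is a family of independent standard normal random variables on `(Ω, P)`. -/
structure IsIIDStdGaussian {Ω ι : Type*} [MeasurableSpace Ω] (P : Measure Ω)
    (x : ι → Ω → ℝ) : Prop where
  hasLaw : ∀ i, HasLaw (x i) (gaussianReal 0 1) P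
  indep : iIndepFun x P

/-- The central limit theorem for the normalized homogeneous sums
`Z n / √(d! ‖q n‖²)`, with `Z n` built from the random variables `X n v`, `v ∈ V n`. The case of
one family `X v`, `v ∈ ⋃ n, V n`, is the one where `X n` is its restriction to `V n`. -/
def SatisfiesCLT {Ω : Type*} [MeasurableSpace Ω] (P : Measure Ω) [IsProbabilityMeasure P]
    {d : ℕ} {V : ℕ → Type*} (X : ∀ n, V n → Ω → ℝ) (E : ∀ n, Finset (Fin d → V n))
    (q : ∀ n, (Fin d → V n) → ℝ) : Prop :=
  TendstoInDistribution
    (fun n ω => homogeneousSum (E n) (q n) (fun v => X n v ω) /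
      √(d ! * coeffNormSq (E n) (q n)))
    atTop (id : ℝ → ℝ) (fun _ => P) (gaussianReal 0 1)

/-! ### Graphs -/

open scoped Classical in
/-- The symmetric non-diagonal set of ordered pairs of adjacent vertices of `G`. -/
def adjPairs {V : Type*} [Fintype V] (G : SimpleGraph V) : Finset (Fin 2 → V) :=
  {v | G.Adj (v 0) (v 1)}

/-- The sequence of graphs `G n` generates an irreducible CLT (the homogeneous sums being
evaluated at the random variables `X n v`): the numbers of vertices and of edges diverge, and the
quadratic forms `Z n = ∑_{v ∼ w} X_v X_w` (sum over ordered pairs) are irreducible and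
asymptotically standard normal after normalization. -/
def GeneratesIrreducibleCLT {Ω : Type*} [MeasurableSpace Ω] (P : Measure Ω)
    [IsProbabilityMeasure P] {V : ℕ → Type*} [∀ n, Fintype (V n)] (X : ∀ n, V n → Ω → ℝ)
    (G : ∀ n, SimpleGraph (V n)) : Prop :=
  Tendsto (fun n => Fintype.card (V n)) atTop atTop ∧
  Tendsto (fun n => (G n).edgeSet.ncard) atTop atTop ∧
  IsIrreducible (fun n => adjPairs (G n)) (fun _ _ => 1) ∧
  SatisfiesCLT P X (fun n => adjPairs (G n)) (fun _ _ => 1)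

/-- The `m`-th Cartesian power of `G`: two `m`-tuples are adjacent when they differ in exactly one
coordinate, in which their entries are adjacent in `G`. -/
def cartesianPower {V : Type*} (G : SimpleGraph V) (m : ℕ) : SimpleGraph (Fin m → V) where
  Adj v w := ∃ j, (∀ i, i ≠ j → v i = w i) ∧ G.Adj (v j) (w j)
  symm := ⟨fun _ _ ⟨j, h, hj⟩ => ⟨j, fun i hi => (h i hi).symm, hj.symm⟩⟩
  loopless := ⟨fun _ ⟨_, _, hj⟩ => G.loopless.irrefl _ hj⟩

/-- The normalized Laplacian `I - D^{-1/2} A D^{-1/2}`. -/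
def normalizedLaplacian {V : Type*} [Fintype V] [DecidableEq V] (G : SimpleGraph V)
    [DecidableRel G.Adj] : Matrix V V ℝ :=
  1 - Matrix.diagonal (fun v => (√(G.degree v : ℝ))⁻¹) * G.adjMatrix ℝ *
    Matrix.diagonal (fun v => (√(G.degree v : ℝ))⁻¹)

theorem isHermitian_normalizedLaplacian {V : Type*} [Fintype V] [DecidableEq V]
    (G : SimpleGraph V) [DecidableRel G.Adj] : (normalizedLaplacian G).IsHermitian := by
  refine Matrix.isHermitian_one.sub ?_
  have h := Matrix.isHermitian_mul_mul_conjTranspose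
    (Matrix.diagonal (fun v => (√(G.degree v : ℝ))⁻¹)) (G.isHermitian_adjMatrix ℝ)
  simpa [Matrix.diagonal_conjTranspose] using h

/-- The `k`-th smallest eigenvalue `μ_k` of the normalized Laplacian, counted with multiplicity,
`μ_1 ≤ μ_2 ≤ ⋯ ≤ μ_N`, for `1 ≤ k ≤ N = |V|` (and `0` for other `k`). Mathlib's list
`eigenvalues₀` is in decreasing order, so that `μ_k` is its entry number `N - k`. -/
def normalizedLaplaceEigenvalue {V : Type*} [Fintype V] [DecidableEq V] (G : SimpleGraph V)
    [DecidableRel G.Adj] (k : ℕ) : ℝ :=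
  if h : 1 ≤ k ∧ k ≤ Fintype.card V then
    (isHermitian_normalizedLaplacian G).eigenvalues₀ ⟨Fintype.card V - k, by omega⟩
  else 0

end HomSum

end

noncomputable section

namespace HomSum

/-! ### Spectral decomposition of real quadratic forms -/

section Spectral

open Matrix WithLp

variable {n : Type*} [Fintype n]

/-! Irreducibility is an expansion statement. For a `d`-regular graph with `N` vertices the spectral
gap is a Poincaré inequality with constant proportional to `d`, and for fixed `m` Cartesian powers
keep such an inequality up to a factor depending only on `m` (`HasPoincare.cartesianPower`). Applied
to the indicator of a box `B`, it says that once `B` is not nearly everything, a fixed fraction of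
the `d * |B|` ordered edges starting in `B` leaves `B`. Disjoint boxes, each with a small share of
the variance, therefore lose a fixed fraction of the total, so their shares cannot sum to `1` in the
limit (`isIrreducible_of_hasPoincare`).

For the CLT, diagonalize the adjacency matrix. By rotation invariance, and because the trace
vanishes, the quadratic form has the law of a weighted sum of independent centred squares of
Gaussians with the eigenvalues as weights (`map_homogeneousSum_adjPairs`). The squared eigenvalues
sum to `N * d` and each is at most `d ^ 2`, so after normalization the largest squared weight is at
most `d / N`. If `d / N` tends to `0`, a comparison of characteristic functions gives normality
(`satisfiesCLT_of_regular`). In the `m`-th power the ratio is `m * d / N ^ m ≤ m / N`, which is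
where `2 ≤ m` enters. -/

theorem dotProduct_eq_inner_toLp (x y : n → ℝ) : x ⬝ᵥ y = inner ℝ (toLp 2 x) (toLp 2 y) := by
  simp [PiLp.inner_apply, dotProduct, mul_comm]

variable [DecidableEq n] {A : Matrix n n ℝ}

theorem inner_eigenvectorBasis_mulVec (hA : A.IsHermitian) (x : n → ℝ) (i : n) :
    inner ℝ (hA.eigenvectorBasis i) (toLp 2 (A *ᵥ x)) =
      hA.eigenvalues i * inner ℝ (hA.eigenvectorBasis i) (toLp 2 x) := by
  have h1 : inner ℝ (hA.eigenvectorBasis i) (toLp 2 (A *ᵥ x)) =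
      (hA.eigenvectorBasis i).ofLp ⬝ᵥ (A *ᵥ x) := (dotProduct_eq_inner_toLp _ _).symm
  have h2 : inner ℝ (hA.eigenvectorBasis i) (toLp 2 x) =
      (hA.eigenvectorBasis i).ofLp ⬝ᵥ x := (dotProduct_eq_inner_toLp _ _).symm
  have hT : Aᵀ = A := by simpa using hA.eq
  rw [h1, h2, dotProduct_mulVec, ← mulVec_transpose, hT, hA.mulVec_eigenvectorBasis,
    smul_dotProduct, smul_eq_mul]

theorem dotProduct_mulVec_eq_sum_eigenvalues (hA : A.IsHermitian) (x : n → ℝ) :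
    x ⬝ᵥ (A *ᵥ x) =
      ∑ i, hA.eigenvalues i * inner ℝ (hA.eigenvectorBasis i) (toLp 2 x) ^ 2 := by
  rw [dotProduct_eq_inner_toLp, ← hA.eigenvectorBasis.sum_inner_mul_inner]
  refine Finset.sum_congr rfl fun i _ => ?_
  rw [inner_eigenvectorBasis_mulVec, real_inner_comm]
  ring

theorem dotProduct_self_eq_sum_inner (hA : A.IsHermitian) (x : n → ℝ) :
    x ⬝ᵥ x = ∑ i, inner ℝ (hA.eigenvectorBasis i) (toLp 2 x) ^ 2 := by
  rw [dotProduct_eq_inner_toLp, ← hA.eigenvectorBasis.sum_inner_mul_inner]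
  refine Finset.sum_congr rfl fun i _ => ?_
  rw [real_inner_comm]
  ring

/-- If the second smallest eigenvalue is positive, it bounds the quadratic form from below on the
orthogonal complement of any nonzero vector of the kernel. -/
theorem eigenvalues₀_mul_dotProduct_self_le (hA : A.IsHermitian) (hn : 2 ≤ Fintype.card n)
    (hpos : 0 < hA.eigenvalues₀ ⟨Fintype.card n - 2, by omega⟩) {u : n → ℝ} (hu : u ≠ 0)
    (hAu : A *ᵥ u = 0) {x : n → ℝ} (hux : u ⬝ᵥ x = 0) :
    hA.eigenvalues₀ ⟨Fintype.card n - 2, by omega⟩ * (x ⬝ᵥ x) ≤ x ⬝ᵥ (A *ᵥ x) := by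
  set μ := hA.eigenvalues₀ ⟨Fintype.card n - 2, by omega⟩ with hμ
  set e : Fin (Fintype.card n) ≃ n := Fintype.equivOfCardEq (Fintype.card_fin _) with he
  -- `eigenvalues₀` is decreasing, so its last entry is the smallest eigenvalue and every other
  -- index carries at least `μ`.
  set i₀ : n := e ⟨Fintype.card n - 1, by omega⟩ with hi₀
  set b := hA.eigenvectorBasis
  have hle : ∀ i, i ≠ i₀ → μ ≤ hA.eigenvalues i := by
    intro i hi
    refine hA.eigenvalues₀_antitone ?_
    have hne : e.symm i ≠ ⟨Fintype.card n - 1, by omega⟩ := by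
      intro h
      exact hi (by rw [hi₀, ← h, Equiv.apply_symm_apply])
    have h1 : (e.symm i : ℕ) ≠ Fintype.card n - 1 := fun h => hne (Fin.ext h)
    have h2 := (e.symm i).2
    rw [Fin.le_def]
    change (e.symm i : ℕ) ≤ Fintype.card n - 2
    omega
  -- Off `i₀` the eigenvalues are positive, so the kernel vector `u` is a multiple of `b i₀`; hence
  -- `x ⊥ u` has no component along `b i₀`.
  have hub : ∀ i, i ≠ i₀ → inner ℝ (b i) (toLp 2 u) = 0 := by
    intro i hi
    have h := inner_eigenvectorBasis_mulVec hA u i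
    rw [hAu, WithLp.toLp_zero, inner_zero_right] at h
    rcases mul_eq_zero.1 h.symm with h0 | h0
    · linarith [hle i hi]
    · exact h0
  have hu0 : inner ℝ (b i₀) (toLp 2 u) ≠ 0 := by
    intro h0
    apply hu
    have hs := dotProduct_self_eq_sum_inner hA u
    rw [Finset.sum_eq_zero] at hs
    · exact dotProduct_self_eq_zero.1 hs
    · intro i _
      by_cases hi : i = i₀
      · rw [hi]; simpa using h0
      · simpa using hub i hi
  have hx0 : inner ℝ (b i₀) (toLp 2 x) = 0 := by
    rw [dotProduct_eq_inner_toLp, ← b.sum_inner_mul_inner,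
      Finset.sum_eq_single i₀ (fun i _ hi => by rw [real_inner_comm, hub i hi, zero_mul])
        (by simp)] at hux
    rcases mul_eq_zero.1 hux with h0 | h0
    · exact absurd (by rw [real_inner_comm, h0]) hu0
    · exact h0
  rw [dotProduct_mulVec_eq_sum_eigenvalues hA, dotProduct_self_eq_sum_inner hA, Finset.mul_sum]
  refine Finset.sum_le_sum fun i _ => ?_
  by_cases hi : i = i₀
  · rw [hi, show inner ℝ (hA.eigenvectorBasis i₀) (toLp 2 x) = 0 from hx0]
    simp
  · exact mul_le_mul_of_nonneg_right (hle i hi) (sq_nonneg _)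

end Spectral

/-! ### Poincaré inequalities on graphs -/

section Poincare

variable {V : Type*} [Fintype V]

open scoped Classical in
theorem sum_adjPairs (G : SimpleGraph V) (F : V → V → ℝ) :
    ∑ p ∈ adjPairs G, F (p 0) (p 1) = ∑ v, ∑ w, if G.Adj v w then F v w else 0 := by
  rw [adjPairs, Finset.sum_filter, ← Fintype.sum_prod_type']
  exact Fintype.sum_equiv (finTwoArrowEquiv V) _ _ fun p => by simp

/-- The Dirichlet energy of `f`, summed over ordered pairs of adjacent vertices. -/
def energy (G : SimpleGraph V) (f : V → ℝ) : ℝ :=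
  ∑ p ∈ adjPairs G, (f (p 0) - f (p 1)) ^ 2

/-- The Poincaré inequality with constant `c`, in the form where the variance is a sum over pairs
of vertices. -/
def HasPoincare (G : SimpleGraph V) (c : ℝ) : Prop :=
  ∀ f : V → ℝ, c * ∑ v, ∑ w, (f v - f w) ^ 2 ≤ Fintype.card V * energy G f

theorem sum_adj_left_of_regular {G : SimpleGraph V} [G.LocallyFinite] {d : ℕ} (hG : G.IsRegularOfDegree d)
    (g : V → ℝ) : ∑ p ∈ adjPairs G, g (p 0) = d * ∑ v, g v := by
  classical
  rw [sum_adjPairs G fun v _ => g v, Finset.mul_sum]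
  refine Finset.sum_congr rfl fun v _ => ?_
  rw [← Finset.sum_filter, Finset.sum_const, nsmul_eq_mul, ← hG v,
    ← G.card_neighborFinset_eq_degree]
  congr 3
  ext w
  simp

theorem sum_adjPairs_comm (G : SimpleGraph V) (F : V → V → ℝ) :
    ∑ p ∈ adjPairs G, F (p 0) (p 1) = ∑ p ∈ adjPairs G, F (p 1) (p 0) := by
  classical
  rw [sum_adjPairs G F, sum_adjPairs G fun v w => F w v, Finset.sum_comm]
  simp_rw [G.adj_comm]

theorem sum_adj_right_of_regular {G : SimpleGraph V} [G.LocallyFinite] {d : ℕ} (hG : G.IsRegularOfDegree d)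
    (g : V → ℝ) : ∑ p ∈ adjPairs G, g (p 1) = d * ∑ v, g v := by
  rw [← sum_adj_left_of_regular hG, sum_adjPairs_comm G fun v _ => g v]

theorem energy_eq_of_regular {G : SimpleGraph V} [G.LocallyFinite] {d : ℕ} (hG : G.IsRegularOfDegree d)
    (f : V → ℝ) :
    energy G f = 2 * (d * ∑ v, f v ^ 2) - 2 * ∑ p ∈ adjPairs G, f (p 0) * f (p 1) := by
  have h1 := sum_adj_left_of_regular hG fun v => f v ^ 2
  have h2 := sum_adj_right_of_regular hG fun v => f v ^ 2
  rw [two_mul (_ * _)]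
  nth_rw 1 [← h1]
  rw [← h2, energy, Finset.mul_sum, ← Finset.sum_add_distrib, ← Finset.sum_sub_distrib]
  exact Finset.sum_congr rfl fun p _ => by ring

theorem sum_sum_sub_sq (f : V → ℝ) :
    ∑ v, ∑ w, (f v - f w) ^ 2 = 2 * (Fintype.card V * ∑ v, f v ^ 2) - 2 * (∑ v, f v) ^ 2 := by
  have h : ∀ v, ∑ w, (f v - f w) ^ 2 =
      Fintype.card V * f v ^ 2 - 2 * f v * ∑ w, f w + ∑ w, f w ^ 2 := by
    intro v
    simp_rw [sub_sq, Finset.sum_add_distrib, Finset.sum_sub_distrib, ← Finset.mul_sum]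
    simp
  simp_rw [h, Finset.sum_add_distrib, Finset.sum_sub_distrib, ← Finset.sum_mul, ← Finset.mul_sum]
  simp
  ring

theorem normalizedLaplacian_mulVec_of_regular [DecidableEq V] {G : SimpleGraph V}
    [DecidableRel G.Adj] {d : ℕ} (hd : 1 ≤ d) (hG : G.IsRegularOfDegree d) (x : V → ℝ) (v : V) :
    (normalizedLaplacian G).mulVec x v = x v - (d : ℝ)⁻¹ * ∑ w, if G.Adj v w then x w else 0 := by
  have hs : (√(d : ℝ))⁻¹ * (√(d : ℝ))⁻¹ = (d : ℝ)⁻¹ := by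
    rw [← mul_inv, Real.mul_self_sqrt (by positivity)]
  have hL : normalizedLaplacian G = 1 - (d : ℝ)⁻¹ • G.adjMatrix ℝ := by
    have hdeg : ∀ v, G.degree v = d := hG
    ext a b
    simp only [normalizedLaplacian, hdeg, Matrix.sub_apply, Matrix.mul_diagonal,
      Matrix.diagonal_mul, Matrix.smul_apply, smul_eq_mul]
    rw [← hs]
    ring
  rw [hL, Matrix.sub_mulVec, Matrix.one_mulVec, Matrix.smul_mulVec, Pi.sub_apply, Pi.smul_apply,
    smul_eq_mul]
  simp [Matrix.mulVec, dotProduct, SimpleGraph.adjMatrix_apply]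

/-- The spectral gap of the normalized Laplacian of a regular graph is a Poincaré constant. -/
theorem hasPoincare_of_normalizedLaplaceEigenvalue_pos [DecidableEq V] {G : SimpleGraph V}
    [DecidableRel G.Adj] {d : ℕ} (hd : 1 ≤ d) (hG : G.IsRegularOfDegree d)
    (hpos : 0 < normalizedLaplaceEigenvalue G 2) :
    HasPoincare G (normalizedLaplaceEigenvalue G 2 * d) := by
  -- With fewer than two vertices `normalizedLaplaceEigenvalue G 2` takes its default value `0`.
  have hcard : 2 ≤ Fintype.card V := by
    by_contra h
    rw [normalizedLaplaceEigenvalue, dif_neg (by omega)] at hpos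
    exact lt_irrefl _ hpos
  have hμ : normalizedLaplaceEigenvalue G 2 =
      (isHermitian_normalizedLaplacian G).eigenvalues₀ ⟨Fintype.card V - 2, by omega⟩ := by
    rw [normalizedLaplaceEigenvalue, dif_pos ⟨by norm_num, hcard⟩]
  have hd0 : (d : ℝ) ≠ 0 := by positivity
  have hN : (0 : ℝ) < Fintype.card V := by
    have : 0 < Fintype.card V := by omega
    exact_mod_cast this
  intro f
  set N : ℝ := (Fintype.card V : ℝ) with hNdef
  set a : ℝ := (∑ v, f v) / N with ha
  -- Centring makes `g` orthogonal to the constants, which span the kernel direction used, and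
  -- changes neither the energy nor the pairwise differences.
  set g : V → ℝ := fun v => f v - a with hg
  have hsum : ∑ v, g v = 0 := by
    simp only [hg, Finset.sum_sub_distrib, Finset.sum_const, Finset.card_univ, nsmul_eq_mul]
    rw [← hNdef, ha]
    field_simp
    ring
  have h1 : (normalizedLaplacian G).mulVec (1 : V → ℝ) = 0 := by
    ext v
    rw [normalizedLaplacian_mulVec_of_regular hd hG]
    have h := hG v
    simp only [Pi.one_apply, Pi.zero_apply]
    rw [← Finset.sum_filter, Finset.sum_const, nsmul_eq_mul, ← G.neighborFinset_eq_filter,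
      G.card_neighborFinset_eq_degree, h]
    field_simp
    ring
  have hne : (1 : V → ℝ) ≠ 0 := by
    have : Nonempty V := Fintype.card_pos_iff.1 (by omega)
    exact one_ne_zero
  have hgap := eigenvalues₀_mul_dotProduct_self_le (isHermitian_normalizedLaplacian G) hcard
    (hμ ▸ hpos) hne h1 (x := g) (by simpa [dotProduct] using hsum)
  rw [← hμ] at hgap
  have hquad : d * (g ⬝ᵥ (normalizedLaplacian G).mulVec g) = energy G g / 2 := by
    have hE : ∑ p ∈ adjPairs G, g (p 0) * g (p 1) =
        ∑ v, g v * ∑ w, if G.Adj v w then g w else 0 := by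
      rw [sum_adjPairs G fun v w => g v * g w]
      refine Finset.sum_congr rfl fun v _ => ?_
      rw [Finset.mul_sum]
      refine Finset.sum_congr rfl fun w _ => ?_
      by_cases h : G.Adj v w <;> simp [h]
    rw [energy_eq_of_regular hG, hE]
    simp only [dotProduct, normalizedLaplacian_mulVec_of_regular hd hG, mul_sub,
      Finset.sum_sub_distrib]
    have : ∀ v, g v * ((d : ℝ)⁻¹ * ∑ w, if G.Adj v w then g w else 0) =
        (d : ℝ)⁻¹ * (g v * ∑ w, if G.Adj v w then g w else 0) := fun v => by ring
    simp_rw [this, ← Finset.mul_sum]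
    field_simp
  have hEg : energy G g = energy G f := by simp [energy, hg]
  have hvar : ∑ v, ∑ w, (f v - f w) ^ 2 = 2 * N * (g ⬝ᵥ g) := by
    have : ∑ v, ∑ w, (f v - f w) ^ 2 = ∑ v, ∑ w, (g v - g w) ^ 2 := by simp [hg]
    rw [this, sum_sum_sub_sq, hsum]
    simp [dotProduct, sq, hNdef]
    ring
  rw [hvar, ← hEg]
  have h2 : energy G g = 2 * (d * (g ⬝ᵥ (normalizedLaplacian G).mulVec g)) := by linarith
  rw [h2]
  have h3 := mul_le_mul_of_nonneg_left hgap (by positivity : (0 : ℝ) ≤ 2 * N * d)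
  linarith

end Poincare

/-! ### Cartesian powers -/

section CartesianPower

variable {V : Type*} [Fintype V] {m : ℕ}

open scoped Classical in
-- A neighbour of `v` amounts to a direction and a new entry; since `G` has no loops the entry
-- really changes, so the direction can be recovered.
theorem sum_adj_cartesianPower (G : SimpleGraph V) (v : Fin m → V) (F : (Fin m → V) → ℝ) :
    (∑ w, if (cartesianPower G m).Adj v w then F w else 0) =
      ∑ j, ∑ b, if G.Adj (v j) b then F (Function.update v j b) else 0 := by
  rw [← Fintype.sum_prod_type', ← Finset.sum_filter, ← Finset.sum_filter]
  symm
  refine Finset.sum_bij (fun p _ => Function.update v p.1 p.2) ?_ ?_ ?_ (fun _ _ => rfl)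
  · intro p hp
    simp only [Finset.mem_filter, Finset.mem_univ, true_and] at hp ⊢
    exact ⟨p.1, fun i hi => by rw [Function.update_of_ne hi],
      by rwa [Function.update_self]⟩
  · rintro ⟨j, b⟩ hp ⟨j', b'⟩ hp' h
    simp only [Finset.mem_filter, Finset.mem_univ, true_and] at hp hp' h
    have hj : j = j' := by
      by_contra hne
      have := congrFun h j
      rw [Function.update_self, Function.update_of_ne hne] at this
      exact hp.ne this.symm
    subst hj
    have := congrFun h j
    rw [Function.update_self, Function.update_self] at this
    rw [this]
  · intro w hw
    simp only [Finset.mem_filter, Finset.mem_univ, true_and] at hw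
    obtain ⟨j, h, hj⟩ := hw
    refine ⟨(j, w j), by simpa using hj, ?_⟩
    ext i
    by_cases hi : i = j
    · subst hi; simp
    · simp [Function.update_of_ne hi, h i hi]

theorem cartesianPower_isRegularOfDegree {G : SimpleGraph V} [G.LocallyFinite]
    [(cartesianPower G m).LocallyFinite] {d : ℕ} (hG : G.IsRegularOfDegree d) :
    (cartesianPower G m).IsRegularOfDegree (m * d) := by
  classical
  intro v
  have h := sum_adj_cartesianPower G v fun _ => 1
  have hdeg : ∀ a, (∑ b, if G.Adj a b then (1 : ℝ) else 0) = d := by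
    intro a
    rw [← Finset.sum_filter, Finset.sum_const, nsmul_eq_mul, mul_one, ← hG a,
      ← G.card_neighborFinset_eq_degree]
    congr 2
    ext w
    simp
  simp_rw [hdeg] at h
  rw [← Finset.sum_filter, Finset.sum_const, nsmul_eq_mul, mul_one] at h
  rw [← SimpleGraph.card_neighborFinset_eq_degree]
  have h' : ((cartesianPower G m).neighborFinset v).card = (m * d : ℝ) := by
    rw [show (m * d : ℝ) = ∑ _j : Fin m, (d : ℝ) by simp, ← h]
    congr 2
    ext w
    simp
  exact_mod_cast h'

/-- Resampling one coordinate: the sum over the configurations of a function of one coordinate and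
of the others is, up to normalization, the sum where that coordinate is resampled. -/
theorem card_mul_sum_eval (j : Fin m) (K : (Fin m → V) → V → ℝ)
    (hK : ∀ v a, K (Function.update v j a) = K v) :
    Fintype.card V * ∑ v, K v (v j) = ∑ v, ∑ a, K v a := by
  have h : ∑ p : (Fin m → V) × V, K p.1 (p.1 j) = ∑ p : (Fin m → V) × V, K p.1 p.2 := by
    -- Exchanging the coordinate `v j` with the extra entry is an involution of the pairs.
    refine Finset.sum_nbij' (fun p => (Function.update p.1 j p.2, p.1 j))
      (fun p => (Function.update p.1 j p.2, p.1 j)) ?_ ?_ ?_ ?_ ?_ <;> simp [hK]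
  rw [← Fintype.sum_prod_type', ← h, Fintype.sum_prod_type]
  simp [Finset.mul_sum]

/-- The part of the Dirichlet energy on the Cartesian power in direction `j`. -/
def directionalEnergy (G : SimpleGraph V) (j : Fin m) (f : (Fin m → V) → ℝ) : ℝ :=
  open scoped Classical in
  ∑ v, ∑ b, if G.Adj (v j) b then (f v - f (Function.update v j b)) ^ 2 else 0

theorem energy_cartesianPower (G : SimpleGraph V) (f : (Fin m → V) → ℝ) :
    energy (cartesianPower G m) f = ∑ j, directionalEnergy G j f := by
  classical
  simp only [energy, directionalEnergy]
  rw [sum_adjPairs (cartesianPower G m) fun v w => (f v - f w) ^ 2,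
    Finset.sum_comm (s := Finset.univ (α := Fin m))]
  refine Finset.sum_congr rfl fun v _ => ?_
  exact sum_adj_cartesianPower G v fun w => (f v - f w) ^ 2

/-- Freezing all coordinates but `j` leaves a function on `V`, to which the inequality for `G`
applies; then sum over the frozen configurations. -/
theorem HasPoincare.directional [Nonempty V] {G : SimpleGraph V} {c : ℝ} (hG : HasPoincare G c)
    (j : Fin m) (f : (Fin m → V) → ℝ) :
    c * ∑ v, ∑ w : Fin m → V, (f v - f (Function.update v j (w j))) ^ 2 ≤
      Fintype.card (Fin m → V) * directionalEnergy G j f := by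
  classical
  set N : ℝ := (Fintype.card V : ℝ) with hN
  set M : ℝ := (Fintype.card (Fin m → V) : ℝ) with hM
  have hN0 : 0 < N := by simp [hN, Fintype.card_pos]
  set g : (Fin m → V) → V → ℝ := fun v a => f (Function.update v j a) with hg
  have hgu : ∀ v a, g (Function.update v j a) = g v := by
    intro v a
    ext b
    simp [hg]
  have hgv : ∀ v, f v = g v (v j) := fun v => by simp [hg]
  -- One factor `N` comes from discarding the coordinates of `w` other than `j`, the other from
  -- resampling `v j`.
  have hD : N ^ 2 * ∑ v, ∑ w : Fin m → V, (f v - f (Function.update v j (w j))) ^ 2 =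
      M * ∑ v, ∑ a, ∑ b, (g v a - g v b) ^ 2 := by
    have h1 : ∀ v, N * ∑ w : Fin m → V, (f v - f (Function.update v j (w j))) ^ 2 =
        M * ∑ b, (g v (v j) - g v b) ^ 2 := by
      intro v
      have := card_mul_sum_eval j (fun (_ : Fin m → V) b => (g v (v j) - g v b) ^ 2)
        (fun _ _ => rfl)
      rw [Finset.sum_const, nsmul_eq_mul, Finset.card_univ] at this
      rw [← this, hgv v]
    rw [sq, mul_assoc, Finset.mul_sum]
    simp_rw [h1]
    rw [← Finset.mul_sum, mul_left_comm,
      card_mul_sum_eval j (fun v a => ∑ b, (g v a - g v b) ^ 2) (fun v a => by rw [hgu])]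
  have hE : N * directionalEnergy G j f = ∑ v, energy G (g v) := by
    have := card_mul_sum_eval j
      (fun v a => ∑ b, if G.Adj a b then (g v a - g v b) ^ 2 else 0) (fun v a => by rw [hgu])
    simp only [energy]
    simp_rw [fun v => sum_adjPairs G fun a b => (g v a - g v b) ^ 2]
    rw [← this, directionalEnergy]
    simp_rw [← hgv]
    rfl
  have hsum : c * ∑ v, ∑ a, ∑ b, (g v a - g v b) ^ 2 ≤ N * ∑ v, energy G (g v) := by
    rw [Finset.mul_sum, Finset.mul_sum]
    exact Finset.sum_le_sum fun v _ => hG (g v)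
  have hM0 : 0 ≤ M := by positivity
  refine le_of_mul_le_mul_left ?_ (pow_pos hN0 2)
  calc N ^ 2 * (c * ∑ v, ∑ w : Fin m → V, (f v - f (Function.update v j (w j))) ^ 2)
      = M * (c * ∑ v, ∑ a, ∑ b, (g v a - g v b) ^ 2) := by
        rw [mul_left_comm, hD, mul_left_comm]
    _ ≤ M * (N * ∑ v, energy G (g v)) := mul_le_mul_of_nonneg_left hsum hM0
    _ = N ^ 2 * (M * directionalEnergy G j f) := by rw [← hE]; ring

/-- Pass from `v` to `w` one coordinate at a time. Each step uses `(a + b) ^ 2 ≤ 2 * a ^ 2 + 2 * b ^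
2`, whence the power of `2`; any constant depending only on `m` suffices. -/
theorem sum_sub_piecewise_sq_le (f : (Fin m → V) → ℝ) (s : Finset (Fin m)) :
    ∑ v, ∑ w, (f v - f (s.piecewise w v)) ^ 2 ≤
      2 ^ s.card * ∑ j ∈ s, ∑ v, ∑ w : Fin m → V, (f v - f (Function.update v j (w j))) ^ 2 := by
  induction s using Finset.induction_on with
  | empty => simp
  | insert j s hj ih =>
    -- Swapping `v` and `w` on `s` is an involution of the pairs that turns this step into a change
    -- of the single coordinate `j`.
    have hswap : ∑ v, ∑ w, (f (s.piecewise w v) - f ((insert j s).piecewise w v)) ^ 2 =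
        ∑ v, ∑ w : Fin m → V, (f v - f (Function.update v j (w j))) ^ 2 := by
      rw [← Fintype.sum_prod_type', ← Fintype.sum_prod_type']
      refine Finset.sum_nbij' (fun p => (s.piecewise p.2 p.1, s.piecewise p.1 p.2))
        (fun p => (s.piecewise p.2 p.1, s.piecewise p.1 p.2)) ?_ ?_ ?_ ?_ ?_
      · simp
      · simp
      · rintro ⟨v, w⟩ _
        ext i <;> by_cases hi : i ∈ s <;> simp [hi]
      · rintro ⟨v, w⟩ _
        ext i <;> by_cases hi : i ∈ s <;> simp [hi]
      · rintro ⟨v, w⟩ _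
        simp [Finset.piecewise_insert, hj]
    have hnn : 0 ≤ ∑ v, ∑ w : Fin m → V, (f v - f (Function.update v j (w j))) ^ 2 :=
      Finset.sum_nonneg fun _ _ => Finset.sum_nonneg fun _ _ => sq_nonneg _
    have htri : ∑ v, ∑ w, (f v - f ((insert j s).piecewise w v)) ^ 2 ≤
        2 * ∑ v, ∑ w, (f v - f (s.piecewise w v)) ^ 2 +
        2 * ∑ v, ∑ w, (f (s.piecewise w v) - f ((insert j s).piecewise w v)) ^ 2 := by
      simp_rw [Finset.mul_sum, ← Finset.sum_add_distrib]
      refine Finset.sum_le_sum fun v _ => Finset.sum_le_sum fun w _ => ?_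
      nlinarith [sq_nonneg (f v - f (s.piecewise w v) -
        (f (s.piecewise w v) - f ((insert j s).piecewise w v)))]
    rw [hswap] at htri
    rw [Finset.card_insert_of_notMem hj, Finset.sum_insert hj, pow_succ]
    have h1 : (1 : ℝ) ≤ 2 ^ s.card := one_le_pow₀ (by norm_num)
    nlinarith [mul_le_mul_of_nonneg_right h1 hnn]

/-- Cartesian powers inherit the Poincaré inequality. -/
theorem HasPoincare.cartesianPower [Nonempty V] {G : SimpleGraph V} {c : ℝ} (hc : 0 ≤ c)
    (hG : HasPoincare G c) : HasPoincare (cartesianPower G m) (c / 2 ^ m) := by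
  intro f
  have h := sum_sub_piecewise_sq_le f Finset.univ
  simp only [Finset.piecewise_univ, Finset.card_univ, Fintype.card_fin] at h
  rw [energy_cartesianPower]
  calc c / 2 ^ m * ∑ v, ∑ w, (f v - f w) ^ 2
      ≤ c / 2 ^ m * (2 ^ m *
          ∑ j, ∑ v, ∑ w : Fin m → V, (f v - f (Function.update v j (w j))) ^ 2) := by
        gcongr
    _ = ∑ j, c * ∑ v, ∑ w : Fin m → V, (f v - f (Function.update v j (w j))) ^ 2 := by
        rw [← Finset.mul_sum]; field_simp
    _ ≤ ∑ j, Fintype.card (Fin m → V) * directionalEnergy G j f :=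
        Finset.sum_le_sum fun j _ => hG.directional j f
    _ = _ := by rw [Finset.mul_sum]

end CartesianPower

/-! ### Irreducibility from a Poincaré inequality -/

section Irreducible

variable {V : Type*} [Fintype V]

theorem coeffNormSq_adjPairs {G : SimpleGraph V} [G.LocallyFinite] {d : ℕ}
    (hG : G.IsRegularOfDegree d) :
    coeffNormSq (adjPairs G) (fun _ => 1) = Fintype.card V * d := by
  have h := sum_adj_left_of_regular hG fun _ => 1
  simp only [coeffNormSq, one_pow]
  rw [h]
  simp [mul_comm]

theorem HasPoincare.mono {G : SimpleGraph V} {c c' : ℝ} (hG : HasPoincare G c) (h : c' ≤ c) :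
    HasPoincare G c' := fun f =>
  (mul_le_mul_of_nonneg_right h
    (Finset.sum_nonneg fun _ _ => Finset.sum_nonneg fun _ _ => sq_nonneg _)).trans (hG f)

/-- The contribution of a box `B` to the variance of the quadratic form of a regular graph is
small when `B` is not nearly everything. -/
theorem boxVariance_le_of_hasPoincare [Nonempty V] {G : SimpleGraph V} [G.LocallyFinite] {d : ℕ}
    (hG : G.IsRegularOfDegree d) {c : ℝ} (hc : 0 ≤ c) (hP : HasPoincare G (c * d))
    (B : Finset V) (hB : boxVariance (adjPairs G) (fun _ => 1) B ≤ Fintype.card V * d)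
    (hd : 1 ≤ d) :
    boxVariance (adjPairs G) (fun _ => 1) B ≤ 2 * (1 - c / 4) * d * B.card := by
  classical
  set N : ℝ := (Fintype.card V : ℝ) with hN
  have hN0 : 0 < N := by simp [hN, Fintype.card_pos]
  have hd0 : (0 : ℝ) < d := by positivity
  set f : V → ℝ := fun v => if v ∈ B then 1 else 0 with hf
  set e : ℝ := ∑ p ∈ adjPairs G, f (p 0) * f (p 1) with he
  have hbox : boxVariance (adjPairs G) (fun _ => 1) B = 2 * e := by
    simp only [boxVariance, he, hf, Finset.sum_filter, Fin.forall_fin_two, one_pow]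
    simp only [← ite_and, mul_ite, mul_one, mul_zero, and_comm]
    norm_num
  have hsumf : ∑ v, f v = B.card := by simp [hf]
  have hff : ∀ v, f v ^ 2 = f v := fun v => by by_cases h : v ∈ B <;> simp [hf, h]
  have hEn := energy_eq_of_regular hG f
  have hvar := sum_sum_sub_sq f
  simp_rw [hff, hsumf] at hEn hvar
  have hP' := hP f
  rw [hvar, hEn, ← hN, ← he] at hP'
  -- The right-hand side counts the ordered edges with both ends outside `B`.
  have hlow : 0 ≤ d * N - 2 * (d * B.card) + e := by
    have h0 : 0 ≤ ∑ p ∈ adjPairs G, (1 - f (p 0)) * (1 - f (p 1)) := by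
      refine Finset.sum_nonneg fun p _ => mul_nonneg ?_ ?_
      · by_cases h : p 0 ∈ B <;> simp [hf, h]
      · by_cases h : p 1 ∈ B <;> simp [hf, h]
    have h1 := sum_adj_left_of_regular hG fun _ => (1 : ℝ)
    have h2 := sum_adj_left_of_regular hG f
    have h3 := sum_adj_right_of_regular hG f
    rw [hsumf] at h2 h3
    have h4 : ∑ p ∈ adjPairs G, (1 - f (p 0)) * (1 - f (p 1)) =
        ∑ p ∈ adjPairs G, (1 : ℝ) - ∑ p ∈ adjPairs G, f (p 0) - ∑ p ∈ adjPairs G, f (p 1) + e := by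
      rw [he, ← Finset.sum_sub_distrib, ← Finset.sum_sub_distrib, ← Finset.sum_add_distrib]
      exact Finset.sum_congr rfl fun p _ => by ring
    rw [h4, h1, h2, h3] at h0
    simp only [Finset.sum_const, Finset.card_univ, nsmul_eq_mul, mul_one, ← hN] at h0
    linarith
  rw [hbox] at hB ⊢
  set b : ℝ := (B.card : ℝ) with hb
  have hb0 : 0 ≤ b := by positivity
  -- `hB` gives `e ≤ N * d / 2`, and `hlow` then forces `2 * d * b ≤ 3 / 2 * d * N`.
  have hbN : b ≤ 3 / 4 * N := by
    have : d * b ≤ d * (3 / 4 * N) := by nlinarith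
    exact le_of_mul_le_mul_left this hd0
  -- For an indicator, `hP'` reads `c * d * b * (N - b) ≤ N * (d * b - e)`, and `N - b ≥ N / 4`.
  have h5 : c * d * b * (N / 4) ≤ N * (d * b - e) := by
    have : c * d * b * (N / 4) ≤ c * d * b * (N - b) := by
      refine mul_le_mul_of_nonneg_left (by linarith) (by positivity)
    linarith
  have h6 : c * d * b / 4 ≤ d * b - e := by
    refine le_of_mul_le_mul_left ?_ hN0
    linarith
  linarith

theorem isIrreducible_of_hasPoincare {V : ℕ → Type*} [∀ n, Fintype (V n)] [∀ n, Nonempty (V n)]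
    (G : ∀ n, SimpleGraph (V n)) [∀ n, (G n).LocallyFinite] (d : ℕ → ℕ)
    (hG : ∀ n, (G n).IsRegularOfDegree (d n)) (hd : ∀ n, 1 ≤ d n) {c : ℝ} (hc : 0 < c)
    (hP : ∀ᶠ n in atTop, HasPoincare (G n) (c * d n)) :
    IsIrreducible (fun n => adjPairs (G n)) (fun _ _ => 1) := by
  classical
  -- This keeps the factor `1 - c / 4` nonnegative when the sizes of the boxes are summed.
  wlog hc4 : c ≤ 4 generalizing c
  · refine this four_pos (hP.mono fun n h => h.mono ?_) le_rfl
    gcongr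
    exact (not_le.1 hc4).le
  rintro ⟨M, B, hdisj, -, hsum, hmax⟩
  -- `1 - c / 4` is the largest share that disjoint boxes can carry once each has share below `1 /
  -- 2`.
  have h1 := hsum.eventually (lt_mem_nhds (show 1 - c / 4 < 1 by linarith))
  have h2 := hmax.eventually (gt_mem_nhds (show (0 : ℝ) < 1 / 2 by norm_num))
  obtain ⟨n, hP, h1, h2⟩ := (hP.and (h1.and h2)).exists
  rw [coeffNormSq_adjPairs (hG n)] at h1 h2
  set N : ℝ := (Fintype.card (V n) : ℝ) with hN
  have hN0 : 0 < N := by simp [hN, Fintype.card_pos]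
  have hd0 : (0 : ℝ) < d n := by exact_mod_cast hd n
  have hS0 : 0 < ((2 ! : ℕ) : ℝ) * (N * d n) := by positivity
  rw [one_div, inv_mul_eq_div] at h1 h2
  rw [div_lt_iff₀ hS0] at h2
  rw [lt_div_iff₀ hS0] at h1
  have h2' : ((2 ! : ℕ) : ℝ) = 2 := by norm_num
  rw [h2'] at h1 h2
  have hle : ∀ i, boxVariance (adjPairs (G n)) (fun _ => 1) (B n i) ≤
      2 * (1 - c / 4) * d n * (B n i).card := by
    intro i
    refine boxVariance_le_of_hasPoincare (hG n) hc.le hP _ ?_ (hd n)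
    have := le_ciSup (Set.finite_range
      fun i => boxVariance (adjPairs (G n)) (fun _ => 1) (B n i)).bddAbove i
    linarith
  have hcard : ∑ i, ((B n i).card : ℝ) ≤ N := by
    have := Finset.card_le_univ (Finset.univ.biUnion (B n))
    rw [Finset.card_biUnion fun i _ j _ hij => hdisj n i j hij] at this
    rw [hN, ← Nat.cast_sum]
    exact Nat.cast_le.2 this
  have htot := Finset.sum_le_sum fun i (_ : i ∈ Finset.univ) => hle i
  rw [← Finset.mul_sum] at htot
  have h3 : 2 * (1 - c / 4) * d n * ∑ i, ((B n i).card : ℝ) ≤ 2 * (1 - c / 4) * d n * N := by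
    refine mul_le_mul_of_nonneg_left hcard ?_
    have : 0 ≤ 1 - c / 4 := by linarith
    exact mul_nonneg (by linarith) hd0.le
  linarith

end Irreducible

/-! ### Central limit theorem for weighted sums of a fixed law -/

section WeightedSums

theorem norm_prod_sub_prod_le {ι : Type*} (s : Finset ι) (a b : ι → ℂ) (ha : ∀ i, ‖a i‖ ≤ 1)
    (hb : ∀ i, ‖b i‖ ≤ 1) : ‖∏ i ∈ s, a i - ∏ i ∈ s, b i‖ ≤ ∑ i ∈ s, ‖a i - b i‖ := by
  classical
  induction s using Finset.induction_on with
  | empty => simp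
  | insert j s hj ih =>
    rw [Finset.prod_insert hj, Finset.prod_insert hj, Finset.sum_insert hj]
    have hpa : ‖∏ i ∈ s, a i‖ ≤ 1 := by
      rw [norm_prod]
      exact Finset.prod_le_one (fun i _ => norm_nonneg _) fun i _ => ha i
    calc ‖a j * ∏ i ∈ s, a i - b j * ∏ i ∈ s, b i‖
        = ‖(a j - b j) * ∏ i ∈ s, a i + b j * (∏ i ∈ s, a i - ∏ i ∈ s, b i)‖ := by ring_nf
      _ ≤ ‖a j - b j‖ * ‖∏ i ∈ s, a i‖ + ‖b j‖ * ‖∏ i ∈ s, a i - ∏ i ∈ s, b i‖ := by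
        refine (norm_add_le _ _).trans ?_
        rw [norm_mul, norm_mul]
      _ ≤ ‖a j - b j‖ * 1 + 1 * ∑ i ∈ s, ‖a i - b i‖ := by
        gcongr
        exact hb j
      _ = _ := by ring

theorem exp_neg_sq_div_two_taylor :
    (fun s : ℝ => Complex.exp (-(s : ℂ) ^ 2 / 2) - (1 - (s : ℂ) ^ 2 / 2)) =o[𝓝 0]
      fun s : ℝ => s ^ 2 := by
  have h := (Complex.hasDerivAt_exp 0).isLittleO
  simp only [sub_zero, Complex.exp_zero, smul_eq_mul, mul_one] at h
  have ht : Tendsto (fun s : ℝ => -(s : ℂ) ^ 2 / 2) (𝓝 0) (𝓝 0) := by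
    have : Continuous fun s : ℝ => -(s : ℂ) ^ 2 / 2 := by fun_prop
    simpa using this.tendsto 0
  have h2 := h.comp_tendsto ht
  refine (h2.congr_left fun s => ?_).trans_isBigO ?_
  · simp only [Function.comp_apply]
    ring
  · refine Asymptotics.IsBigO.of_bound 1 (Eventually.of_forall fun s => ?_)
    simp only [Function.comp_apply, norm_div, norm_neg, norm_pow, Complex.norm_real,
      Complex.norm_ofNat, Real.norm_eq_abs]
    nlinarith [sq_nonneg |s|]

/-- Compare with the Gaussian factors one by one: each error is `o((a n i * t) ^ 2)`, uniformly in
`i` because `r` bounds the squared weights, and these squares sum to `t ^ 2`. -/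
theorem tendsto_prod_of_taylor {ι : ℕ → Type*} [∀ n, Fintype (ι n)] {f : ℝ → ℂ}
    (hf1 : ∀ s, ‖f s‖ ≤ 1)
    (hf : (fun s : ℝ => f s - (1 - (s : ℂ) ^ 2 / 2)) =o[𝓝 0] fun s : ℝ => s ^ 2)
    {a : ∀ n, ι n → ℝ} (ha : ∀ᶠ n in atTop, ∑ i, a n i ^ 2 = 1) {r : ℕ → ℝ}
    (hr : Tendsto r atTop (𝓝 0)) (har : ∀ n i, a n i ^ 2 ≤ r n) (t : ℝ) :
    Tendsto (fun n => ∏ i, f (a n i * t)) atTop (𝓝 (Complex.exp (-(t : ℂ) ^ 2 / 2))) := by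
  have hdiff := hf.sub exp_neg_sq_div_two_taylor
  rw [Metric.tendsto_nhds]
  intro ε hε
  -- The `+ 1` keeps the quotient meaningful at `t = 0`; the total error is then at most `ε / 2`.
  have hη : 0 < ε / (2 * (t ^ 2 + 1)) := by positivity
  obtain ⟨δ, hδ, hball⟩ := Metric.eventually_nhds_iff.1 (hdiff.def hη)
  have hsmall : ∀ᶠ n in atTop, r n * t ^ 2 < δ ^ 2 := by
    have : Tendsto (fun n => r n * t ^ 2) atTop (𝓝 0) := by simpa using hr.mul_const (t ^ 2)
    exact this.eventually (gt_mem_nhds (by positivity))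
  filter_upwards [ha, hsmall] with n hn hs
  have hexp : Complex.exp (-(t : ℂ) ^ 2 / 2) =
      ∏ i, Complex.exp (-((a n i * t : ℝ) : ℂ) ^ 2 / 2) := by
    rw [← Complex.exp_sum]
    congr 1
    have : ((∑ i, a n i ^ 2 : ℝ) : ℂ) = 1 := by rw [hn]; simp
    rw [← mul_one (-(t : ℂ) ^ 2 / 2), ← this]
    push_cast
    rw [Finset.mul_sum]
    exact Finset.sum_congr rfl fun i _ => by ring
  have hb1 : ∀ s : ℝ, ‖Complex.exp (-(s : ℂ) ^ 2 / 2)‖ ≤ 1 := by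
    intro s
    have : -(s : ℂ) ^ 2 / 2 = ((-s ^ 2 / 2 : ℝ) : ℂ) := by push_cast; ring
    rw [this, Complex.norm_exp_ofReal, Real.exp_le_one_iff]
    nlinarith [sq_nonneg s]
  rw [dist_eq_norm, hexp]
  calc ‖∏ i, f (a n i * t) - ∏ i, Complex.exp (-((a n i * t : ℝ) : ℂ) ^ 2 / 2)‖
      ≤ ∑ i, ‖f (a n i * t) - Complex.exp (-((a n i * t : ℝ) : ℂ) ^ 2 / 2)‖ :=
        norm_prod_sub_prod_le _ _ _ (fun _ => hf1 _) fun _ => hb1 _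
    _ ≤ ∑ i, ε / (2 * (t ^ 2 + 1)) * (a n i * t) ^ 2 := by
        refine Finset.sum_le_sum fun i _ => ?_
        have hi : dist (a n i * t) 0 < δ := by
          rw [Real.dist_eq, sub_zero]
          refine abs_lt_of_sq_lt_sq ?_ hδ.le
          calc (a n i * t) ^ 2 = a n i ^ 2 * t ^ 2 := by ring
            _ ≤ r n * t ^ 2 := mul_le_mul_of_nonneg_right (har n i) (sq_nonneg t)
            _ < δ ^ 2 := hs
        have := hball hi
        rw [Real.norm_of_nonneg (sq_nonneg _)] at this
        refine le_trans (le_of_eq ?_) this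
        congr 1
        ring
    _ = ε / (2 * (t ^ 2 + 1)) * t ^ 2 := by
        simp_rw [mul_pow]
        rw [← Finset.mul_sum, ← Finset.sum_mul, hn, one_mul]
    _ < ε := by
        rw [div_mul_eq_mul_div, div_lt_iff₀ (by positivity)]
        nlinarith [sq_nonneg t]

theorem charFun_map_sum_comp {ι : Type*} [Fintype ι] (γ : Measure ℝ) [IsProbabilityMeasure γ]
    {w : ℝ → ℝ} (hw : Measurable w) (a : ι → ℝ) (t : ℝ) :
    charFun ((Measure.pi fun _ : ι => γ).map fun y => ∑ i, a i * w (y i)) t =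
      ∏ i, charFun (γ.map w) (a i * t) := by
  have hm : Measurable fun y : ι → ℝ => ∑ i, a i * w (y i) :=
    Finset.measurable_sum _ fun i _ => (hw.comp (measurable_pi_apply i)).const_mul _
  rw [charFun_apply_real, integral_map hm.aemeasurable (by fun_prop)]
  have h : ∀ y : ι → ℝ, Complex.exp (t * (∑ i, a i * w (y i) : ℝ) * Complex.I) =
      ∏ i, Complex.exp (((a i * t : ℝ) : ℂ) * (w (y i) : ℂ) * Complex.I) := by
    intro y
    rw [← Complex.exp_sum]
    congr 1
    push_cast
    rw [Finset.mul_sum, Finset.sum_mul]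
    exact Finset.sum_congr rfl fun i _ => by ring
  simp_rw [h]
  rw [integral_fintype_prod_eq_prod
    (f := fun i x => Complex.exp (((a i * t : ℝ) : ℂ) * (w x : ℂ) * Complex.I))]
  refine Finset.prod_congr rfl fun i _ => ?_
  rw [charFun_apply_real, integral_map (by fun_prop) (by fun_prop)]

end WeightedSums

/-! ### Moments of the standard Gaussian law -/

section GaussianMoments

theorem integral_sq_gaussianReal : ∫ x, x ^ 2 ∂gaussianReal 0 1 = 1 := by
  have h := variance_fun_id_gaussianReal (μ := 0) (v := 1)
  rw [variance_eq_integral (by fun_prop)] at h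
  simpa using h

/-- Needed for the unit variance of `centeredSq`. By evenness it reduces to a half-line integral, a
value of the Gamma function at `5 / 2`. -/
theorem integral_pow_four_gaussianReal : ∫ x, x ^ 4 ∂gaussianReal 0 1 = 3 := by
  rw [integral_gaussianReal_eq_integral_smul one_ne_zero]
  have habs : ∀ x : ℝ, gaussianPDFReal 0 1 x • x ^ 4 =
      (fun y => (√(2 * Real.pi))⁻¹ * (y ^ (4 : ℝ) * Real.exp (-(1 / 2) * y ^ (2 : ℝ)))) |x| := by
    intro x
    rw [gaussianPDFReal]
    simp only [NNReal.coe_one, mul_one, sub_zero, smul_eq_mul]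
    rw [show (4 : ℝ) = ((4 : ℕ) : ℝ) by norm_num, show (2 : ℝ) = ((2 : ℕ) : ℝ) by norm_num,
      Real.rpow_natCast, Real.rpow_natCast, sq_abs, Even.pow_abs (by decide)]
    push_cast
    ring_nf
  simp_rw [habs]
  rw [integral_comp_abs (f := fun y : ℝ =>
      (√(2 * Real.pi))⁻¹ * (y ^ (4 : ℝ) * Real.exp (-(1 / 2) * y ^ (2 : ℝ)))),
    integral_const_mul,
    integral_rpow_mul_exp_neg_mul_rpow (by norm_num) (by norm_num) (by norm_num)]
  have hG : Real.Gamma ((4 + 1) / 2) = 3 / 4 * √Real.pi := by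
    rw [show ((4 : ℝ) + 1) / 2 = (1 / 2 + 1) + 1 by norm_num, Real.Gamma_add_one (by norm_num),
      Real.Gamma_add_one (by norm_num), Real.Gamma_one_half_eq]
    ring
  have hp : ((1 : ℝ) / 2) ^ (-(4 + 1) / 2 : ℝ) = 4 * √2 := by
    rw [one_div, Real.inv_rpow (by norm_num), ← Real.rpow_neg (by norm_num),
      show (-(-((4 : ℝ) + 1) / 2)) = 2 + 1 / 2 by norm_num, Real.rpow_add (by norm_num),
      ← Real.sqrt_eq_rpow]
    norm_num
  rw [hG, hp, Real.sqrt_mul (by norm_num)]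
  have h1 : √(2 : ℝ) ≠ 0 := by positivity
  have h2 : √Real.pi ≠ 0 := by positivity
  field_simp

theorem integrable_pow_gaussianReal (k : ℕ) :
    Integrable (fun x : ℝ => x ^ k) (gaussianReal 0 1) := by
  have h := (memLp_id_gaussianReal (μ := 0) (v := 1) k).integrable_norm_pow'
  refine h.mono (by fun_prop) (Eventually.of_forall fun x => ?_)
  simp

/-- The normalized centered square of a standard Gaussian variable. -/
def centeredSq (y : ℝ) : ℝ := (y ^ 2 - 1) / √2

theorem measurable_centeredSq : Measurable centeredSq := by
  unfold centeredSq
  fun_prop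

theorem integral_centeredSq : ∫ y, centeredSq y ∂gaussianReal 0 1 = 0 := by
  simp only [centeredSq]
  rw [integral_div, integral_sub (integrable_pow_gaussianReal 2) (integrable_const _),
    integral_sq_gaussianReal]
  simp

theorem integral_centeredSq_sq : ∫ y, centeredSq y ^ 2 ∂gaussianReal 0 1 = 1 := by
  have h : ∀ y : ℝ, centeredSq y ^ 2 = (y ^ 4 - 2 * y ^ 2 + 1) / 2 := by
    intro y
    rw [centeredSq, div_pow, Real.sq_sqrt (by norm_num)]
    ring
  simp_rw [h]
  rw [integral_div, integral_add, integral_sub, integral_const_mul, integral_sq_gaussianReal,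
    integral_pow_four_gaussianReal]
  · norm_num
  · exact integrable_pow_gaussianReal 4
  · exact (integrable_pow_gaussianReal 2).const_mul 2
  · exact (integrable_pow_gaussianReal 4).sub ((integrable_pow_gaussianReal 2).const_mul 2)
  · exact integrable_const _

theorem charFun_centeredSq_taylor :
    (fun s : ℝ => charFun ((gaussianReal 0 1).map centeredSq) s - (1 - (s : ℂ) ^ 2 / 2)) =o[𝓝 0]
      fun s : ℝ => s ^ 2 :=
  taylor_charFun_two measurable_centeredSq.aemeasurable integral_centeredSq
    integral_centeredSq_sq

end GaussianMoments

/-! ### Gaussian quadratic forms of regular graphs -/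

section QuadraticForm

open Matrix WithLp

variable {V : Type*} [Fintype V]

theorem homogeneousSum_adjPairs [DecidableEq V] (G : SimpleGraph V) [DecidableRel G.Adj]
    (x : V → ℝ) :
    homogeneousSum (adjPairs G) (fun _ => 1) x =
      ∑ i, (G.isHermitian_adjMatrix ℝ).eigenvalues i *
        inner ℝ ((G.isHermitian_adjMatrix ℝ).eigenvectorBasis i) (toLp 2 x) ^ 2 := by
  rw [← dotProduct_mulVec_eq_sum_eigenvalues, homogeneousSum]
  simp only [Fin.prod_univ_two, one_mul]
  rw [sum_adjPairs G fun v w => x v * x w]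
  simp only [dotProduct, Matrix.mulVec, SimpleGraph.adjMatrix_apply, Finset.mul_sum]
  refine Finset.sum_congr rfl fun v _ => Finset.sum_congr rfl fun w _ => ?_
  by_cases h : G.Adj v w <;> simp [h]

/-- The absence of loops makes the trace vanish; this is what allows the squares to be centred for
free. -/
theorem sum_eigenvalues_adjMatrix [DecidableEq V] (G : SimpleGraph V) [DecidableRel G.Adj] :
    ∑ i, (G.isHermitian_adjMatrix ℝ).eigenvalues i = 0 := by
  have h := (G.isHermitian_adjMatrix ℝ).trace_eq_sum_eigenvalues
  rw [SimpleGraph.trace_adjMatrix] at h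
  exact_mod_cast h.symm

/-- Both sides equal the sum of `‖A e_v‖ ^ 2` over the standard basis, by Parseval in the
eigenbasis. -/
theorem sum_eigenvalues_sq {n : Type*} [Fintype n] [DecidableEq n] {A : Matrix n n ℝ}
    (hA : A.IsHermitian) : ∑ i, hA.eigenvalues i ^ 2 = ∑ v, ∑ w, A v w ^ 2 := by
  have hone : ∀ i, ∑ v, inner ℝ (hA.eigenvectorBasis i) (toLp 2 (Pi.single v (1 : ℝ))) ^ 2 = 1 := by
    intro i
    have h1 : ‖hA.eigenvectorBasis i‖ ^ 2 = 1 := by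
      rw [hA.eigenvectorBasis.orthonormal.1 i, one_pow]
    rw [EuclideanSpace.real_norm_sq_eq] at h1
    refine Eq.trans ?_ h1
    refine Finset.sum_congr rfl fun v _ => ?_
    congr 1
    exact (dotProduct_eq_inner_toLp _ _).symm.trans 
      (by rw [dotProduct_single, mul_one]; rfl)
  calc ∑ i, hA.eigenvalues i ^ 2
      = ∑ i, ∑ v, (hA.eigenvalues i *
          inner ℝ (hA.eigenvectorBasis i) (toLp 2 (Pi.single v (1 : ℝ)))) ^ 2 := by
        simp_rw [mul_pow, ← Finset.mul_sum, hone, mul_one]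
    _ = ∑ v, (A *ᵥ Pi.single v 1) ⬝ᵥ (A *ᵥ Pi.single v 1) := by
        rw [Finset.sum_comm]
        refine Finset.sum_congr rfl fun v _ => ?_
        rw [dotProduct_self_eq_sum_inner hA]
        simp_rw [inner_eigenvectorBasis_mulVec]
    _ = ∑ v, ∑ w, A v w ^ 2 := by
        rw [Finset.sum_comm]
        refine Finset.sum_congr rfl fun v _ => ?_
        simp [dotProduct, sq]

theorem sum_eigenvalues_sq_of_regular [DecidableEq V] {G : SimpleGraph V} [DecidableRel G.Adj]
    [G.LocallyFinite] {d : ℕ} (hG : G.IsRegularOfDegree d) :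
    ∑ i, (G.isHermitian_adjMatrix ℝ).eigenvalues i ^ 2 = Fintype.card V * d := by
  rw [sum_eigenvalues_sq, ← coeffNormSq_adjPairs hG, coeffNormSq, sum_adjPairs G fun _ _ => 1 ^ 2]
  refine Finset.sum_congr rfl fun v _ => Finset.sum_congr rfl fun w _ => ?_
  by_cases h : G.Adj v w <;> simp [SimpleGraph.adjMatrix_apply, h]

/-- For a unit eigenvector, sum `(x v ± x w) ^ 2 ≥ 0` over the edges. -/
theorem eigenvalues_adjMatrix_sq_le [DecidableEq V] {G : SimpleGraph V} [DecidableRel G.Adj]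
    [G.LocallyFinite] {d : ℕ} (hG : G.IsRegularOfDegree d) (i : V) :
    (G.isHermitian_adjMatrix ℝ).eigenvalues i ^ 2 ≤ (d : ℝ) ^ 2 := by
  set hA := G.isHermitian_adjMatrix ℝ
  set x : V → ℝ := (hA.eigenvectorBasis i).ofLp with hx
  have hxx : ∑ v, x v ^ 2 = 1 := by
    rw [hx, ← EuclideanSpace.real_norm_sq_eq, hA.eigenvectorBasis.orthonormal.1 i, one_pow]
  have hval : hA.eigenvalues i = ∑ p ∈ adjPairs G, x (p 0) * x (p 1) := by
    rw [hA.eigenvalues_eq, sum_adjPairs G fun v w => x v * x w]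
    simp only [dotProduct, Matrix.mulVec, SimpleGraph.adjMatrix_apply, Finset.mul_sum]
    simp only [RCLike.re_to_real]
    refine Finset.sum_congr rfl fun v _ => Finset.sum_congr rfl fun w _ => ?_
    by_cases h : G.Adj v w <;> simp [h, hx]
  have h1 := sum_adj_left_of_regular hG fun v => x v ^ 2
  have h2 := sum_adj_right_of_regular hG fun v => x v ^ 2
  rw [hxx, mul_one] at h1 h2
  have hpos : 0 ≤ ∑ p ∈ adjPairs G, (x (p 0) + x (p 1)) ^ 2 :=
    Finset.sum_nonneg fun _ _ => sq_nonneg _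
  have hneg : 0 ≤ ∑ p ∈ adjPairs G, (x (p 0) - x (p 1)) ^ 2 :=
    Finset.sum_nonneg fun _ _ => sq_nonneg _
  simp_rw [add_sq, Finset.sum_add_distrib, mul_assoc, ← Finset.mul_sum] at hpos
  simp_rw [sub_sq, Finset.sum_add_distrib, Finset.sum_sub_distrib, mul_assoc,
    ← Finset.mul_sum] at hneg
  rw [h1, h2, ← hval] at hpos hneg
  exact sq_le_sq' (by linarith) (by linarith)

theorem IsIIDStdGaussian.map_eq_pi {Ω : Type*} [MeasurableSpace Ω] {P : Measure Ω}
    [IsProbabilityMeasure P] {X : V → Ω → ℝ} (hX : IsIIDStdGaussian P X) :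
    P.map (fun ω v => X v ω) = Measure.pi fun _ => gaussianReal 0 1 := by
  rw [(iIndepFun_iff_map_fun_eq_pi_map fun v => (hX.hasLaw v).aemeasurable).1 hX.indep]
  simp_rw [fun v => (hX.hasLaw v).map_eq]

theorem IsIIDStdGaussian.aemeasurable {Ω : Type*} [MeasurableSpace Ω] {P : Measure Ω}
    {X : V → Ω → ℝ} (hX : IsIIDStdGaussian P X) : AEMeasurable (fun ω v => X v ω) P :=
  aemeasurable_pi_iff.2 fun v => (hX.hasLaw v).aemeasurable

/-- The coordinates of a standard Gaussian vector in an orthonormal basis are again independent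
standard Gaussian. -/
theorem map_inner_orthonormalBasis_pi_gaussianReal
    (b : OrthonormalBasis V ℝ (EuclideanSpace ℝ V)) :
    (Measure.pi fun _ : V => gaussianReal 0 1).map (fun x i => inner ℝ (b i) (toLp 2 x)) =
      Measure.pi fun _ => gaussianReal 0 1 := by
  have h : (fun (x : V → ℝ) i => inner ℝ (b i) (toLp 2 x)) =
      (WithLp.ofLp : EuclideanSpace ℝ V → V → ℝ) ∘ b.repr ∘ (toLp 2) := by
    ext x i
    simp [b.repr_apply_apply]
  rw [h, ← Measure.map_map (by fun_prop) (by fun_prop), ← Measure.map_map (by fun_prop)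
    (by fun_prop), map_pi_eq_stdGaussian, stdGaussian_map, ← map_pi_eq_stdGaussian,
    Measure.map_map (by fun_prop) (by fun_prop)]
  exact Measure.map_id

theorem map_homogeneousSum_adjPairs [DecidableEq V] {G : SimpleGraph V} [DecidableRel G.Adj]
    {Ω : Type*} [MeasurableSpace Ω] {P : Measure Ω} [IsProbabilityMeasure P] {X : V → Ω → ℝ}
    (hX : IsIIDStdGaussian P X) (s : ℝ) :
    P.map (fun ω => homogeneousSum (adjPairs G) (fun _ => 1) (fun v => X v ω) / √(2 * s)) =
      (Measure.pi fun _ : V => gaussianReal 0 1).map fun y =>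
        ∑ i, (G.isHermitian_adjMatrix ℝ).eigenvalues i / √s * centeredSq (y i) := by
  set hA := G.isHermitian_adjMatrix ℝ
  set Q : (V → ℝ) → ℝ := fun y => ∑ i, hA.eigenvalues i / √s * centeredSq (y i) with hQ
  have hQm : Measurable Q := Finset.measurable_sum _ fun i _ =>
    (measurable_centeredSq.comp (measurable_pi_apply i)).const_mul _
  have h : (fun ω => homogeneousSum (adjPairs G) (fun _ => 1) (fun v => X v ω) / √(2 * s)) =
      (Q ∘ fun (x : V → ℝ) i => inner ℝ (hA.eigenvectorBasis i) (toLp 2 x)) ∘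
        fun ω v => X v ω := by
    ext ω
    have h0 := sum_eigenvalues_adjMatrix G
    simp only [Function.comp_apply, hQ]
    rw [homogeneousSum_adjPairs, Real.sqrt_mul (by norm_num)]
    have : ∀ i, hA.eigenvalues i / √s * centeredSq
        (inner ℝ (hA.eigenvectorBasis i) (toLp 2 fun v => X v ω)) =
        (hA.eigenvalues i * inner ℝ (hA.eigenvectorBasis i) (toLp 2 fun v => X v ω) ^ 2
          - hA.eigenvalues i) / (√2 * √s) := by
      intro i
      rw [centeredSq, div_mul_div_comm, mul_comm √s]
      ring
    simp_rw [this]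
    rw [← Finset.sum_div, Finset.sum_sub_distrib, h0, sub_zero]
  have hm : Measurable fun (x : V → ℝ) i => inner ℝ (hA.eigenvectorBasis i) (toLp 2 x) := by
    fun_prop
  rw [h, ← AEMeasurable.map_map_of_aemeasurable (hQm.comp hm).aemeasurable hX.aemeasurable,
    hX.map_eq_pi, ← Measure.map_map hQm hm, map_inner_orthonormalBasis_pi_gaussianReal]

end QuadraticForm

theorem aemeasurable_homogeneousSum {V : Type*} {Ω : Type*} [MeasurableSpace Ω] {P : Measure Ω}
    {X : V → Ω → ℝ} (hX : IsIIDStdGaussian P X) {k : ℕ} (E : Finset (Fin k → V))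
    (q : (Fin k → V) → ℝ) : AEMeasurable (fun ω => homogeneousSum E q fun v => X v ω) P := by
  have h : ∀ v ∈ E, AEMeasurable (fun ω => q v * ∏ i, X (v i) ω) P := fun v _ =>
    (Finset.aemeasurable_fun_prod _ fun i _ => (hX.hasLaw (v i)).aemeasurable).const_mul (q v)
  exact Finset.aemeasurable_fun_sum E h

/-- The quadratic forms of regular graphs of degree negligible with respect to the number of
vertices are asymptotically normal. -/
theorem satisfiesCLT_of_regular {Ω : Type*} [MeasurableSpace Ω] (P : Measure Ω)
    [IsProbabilityMeasure P] {V : ℕ → Type*} [∀ n, Fintype (V n)] [∀ n, Nonempty (V n)]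
    (G : ∀ n, SimpleGraph (V n)) [∀ n, (G n).LocallyFinite] (d : ℕ → ℕ)
    (hG : ∀ n, (G n).IsRegularOfDegree (d n)) (hd : ∀ n, 1 ≤ d n)
    (hlim : Tendsto (fun n => (d n : ℝ) / Fintype.card (V n)) atTop (𝓝 0))
    (X : ∀ n, V n → Ω → ℝ) (hX : ∀ n, IsIIDStdGaussian P (X n)) :
    SatisfiesCLT P X (fun n => adjPairs (G n)) (fun _ _ => 1) := by
  classical
  have hs : ∀ n, (0 : ℝ) < Fintype.card (V n) * d n := fun n =>
    mul_pos (by simp [Fintype.card_pos]) (by exact_mod_cast hd n)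
  refine ⟨fun n => (aemeasurable_homogeneousSum (hX n) _ _).div_const _, aemeasurable_id, ?_⟩
  refine ProbabilityMeasure.tendsto_iff_tendsto_charFun.2 fun t => ?_
  have hlimit : charFun ((gaussianReal 0 1).map (id : ℝ → ℝ)) t =
      Complex.exp (-(t : ℂ) ^ 2 / 2) := by
    rw [Measure.map_id, charFun_gaussianReal]
    simp [neg_div]
  have hlaw : ∀ n, charFun (P.map fun ω => homogeneousSum (adjPairs (G n)) (fun _ => 1)
      (fun v => X n v ω) / √(((2 ! : ℕ) : ℝ) * coeffNormSq (adjPairs (G n)) fun _ => 1)) t =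
      ∏ i, charFun ((gaussianReal 0 1).map centeredSq)
        (((G n).isHermitian_adjMatrix ℝ).eigenvalues i / √(Fintype.card (V n) * d n) * t) := by
    intro n
    rw [coeffNormSq_adjPairs (hG n), show ((2 ! : ℕ) : ℝ) = 2 by norm_num,
      map_homogeneousSum_adjPairs (hX n), charFun_map_sum_comp _ measurable_centeredSq]
  have hprob : IsProbabilityMeasure ((gaussianReal 0 1).map centeredSq) :=
    Measure.isProbabilityMeasure_map measurable_centeredSq.aemeasurable
  have key := tendsto_prod_of_taylor (ι := V)
    (f := charFun ((gaussianReal 0 1).map centeredSq))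
    (fun s => norm_charFun_le_one s) charFun_centeredSq_taylor
    (a := fun n i => ((G n).isHermitian_adjMatrix ℝ).eigenvalues i / √(Fintype.card (V n) * d n))
    (Eventually.of_forall fun n => ?_) hlim (fun n i => ?_) t
  · simp only [ProbabilityMeasure.coe_mk]
    rw [hlimit]
    exact key.congr fun n => (hlaw n).symm
  · simp_rw [div_pow]
    rw [← Finset.sum_div, sum_eigenvalues_sq_of_regular (hG n), Real.sq_sqrt (hs n).le,
      div_self (hs n).ne']
  · rw [div_pow, Real.sq_sqrt (hs n).le]
    have hN : (0 : ℝ) < Fintype.card (V n) := by simp [Fintype.card_pos]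
    rw [div_le_div_iff₀ (hs n) hN]
    have := mul_le_mul_of_nonneg_right (eigenvalues_adjMatrix_sq_le (hG n) i) hN.le
    linarith

/-! ### Cartesian powers of regular graphs with a uniform Poincaré inequality -/

theorem generatesIrreducibleCLT_cartesianPower {m : ℕ} (hm : 2 ≤ m) {Ω : Type*}
    [MeasurableSpace Ω] (P : Measure Ω) [IsProbabilityMeasure P] {V : ℕ → Type*}
    [∀ n, Fintype (V n)] [∀ n, DecidableEq (V n)] [∀ n, Nonempty (V n)]
    (G : ∀ n, SimpleGraph (V n)) [∀ n, (G n).LocallyFinite] (d : ℕ → ℕ)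
    (hG : ∀ n, (G n).IsRegularOfDegree (d n)) (hd : ∀ n, 1 ≤ d n)
    (hcard : Tendsto (fun n => Fintype.card (V n)) atTop atTop) {c : ℝ} (hc : 0 < c)
    (hP : ∀ᶠ n in atTop, HasPoincare (G n) (c * d n))
    (X : ∀ n, (Fin m → V n) → Ω → ℝ) (hX : ∀ n, IsIIDStdGaussian P (X n)) :
    GeneratesIrreducibleCLT P X (fun n => cartesianPower (G n) m) := by
  classical
  have hreg : ∀ n, (cartesianPower (G n) m).IsRegularOfDegree (m * d n) := fun n =>
    cartesianPower_isRegularOfDegree (hG n)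
  have hmd : ∀ n, 1 ≤ m * d n := fun n => Nat.mul_pos (by omega) (hd n)
  have hN1 : ∀ n, 1 ≤ Fintype.card (V n) := fun n => Fintype.card_pos
  have hcardm : Tendsto (fun n => Fintype.card (Fin m → V n)) atTop atTop := by
    refine tendsto_atTop_mono (fun n => ?_) hcard
    rw [Fintype.card_fun, Fintype.card_fin]
    exact Nat.le_self_pow (by omega) _
  refine ⟨hcardm, ?_, ?_, ?_⟩
  · have hedge : ∀ n, Fintype.card (Fin m → V n) ≤
        (cartesianPower (G n) m).edgeSet.ncard := by
      intro n
      have h := (cartesianPower (G n) m).sum_degrees_eq_twice_card_edges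
      simp_rw [fun v => (hreg n).degree_eq v] at h
      rw [Finset.sum_const, Finset.card_univ, smul_eq_mul] at h
      rw [Set.ncard_eq_toFinset_card', Set.toFinset_card, ← SimpleGraph.edgeFinset_card]
      -- Degree at least `2` gives at least as many edges as vertices.
      have h2 : 2 ≤ m * d n := hm.trans (Nat.le_mul_of_pos_right _ (hd n))
      have := Nat.mul_le_mul_left (Fintype.card (Fin m → V n)) h2
      omega
    exact tendsto_atTop_mono hedge hcardm
  -- Taking the power costs `2 ^ m`, and expressing the constant relative to the new degree `m * d
  -- n` costs a further `m`.
  · refine isIrreducible_of_hasPoincare _ (fun n => m * d n) hreg hmd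
      (c := c / (2 ^ m * m)) (by positivity) ?_
    filter_upwards [hP] with n hn
    convert hn.cartesianPower (m := m) (by positivity) using 1
    have : (m : ℝ) ≠ 0 := by
      have : m ≠ 0 := by omega
      exact_mod_cast this
    push_cast
    field_simp
  · refine satisfiesCLT_of_regular P _ (fun n => m * d n) hreg hmd ?_ X hX
    have hinv : Tendsto (fun n => (m : ℝ) / Fintype.card (V n)) atTop (𝓝 0) :=
      (tendsto_natCast_atTop_atTop.comp hcard).const_div_atTop _
    refine squeeze_zero (fun n => by positivity) (fun n => ?_) hinv
    have hN : (0 : ℝ) < Fintype.card (V n) := by exact_mod_cast hN1 n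
    have hdN : (d n : ℝ) ≤ Fintype.card (V n) := by
      obtain ⟨v⟩ := (inferInstance : Nonempty (V n))
      have h := Finset.card_le_univ ((G n).neighborFinset v)
      rw [SimpleGraph.card_neighborFinset_eq_degree, hG n v] at h
      exact_mod_cast h
    have hpow : (Fintype.card (V n) : ℝ) ^ 2 ≤ Fintype.card (Fin m → V n) := by
      rw [Fintype.card_fun, Fintype.card_fin, Nat.cast_pow]
      exact pow_le_pow_right₀ (by exact_mod_cast hN1 n) hm
    rw [div_le_div_iff₀ (lt_of_lt_of_le (by positivity) hpow) hN]
    push_cast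
    calc (m : ℝ) * d n * Fintype.card (V n)
        ≤ m * Fintype.card (V n) * Fintype.card (V n) := by gcongr
      _ = m * (Fintype.card (V n) : ℝ) ^ 2 := by ring
      _ ≤ m * Fintype.card (Fin m → V n) := by gcongr

/-! ### Complete and complete bipartite graphs -/

theorem hasPoincare_top (V : Type*) [Fintype V] :
    HasPoincare (⊤ : SimpleGraph V) (Fintype.card V) := by
  classical
  intro f
  rw [energy, sum_adjPairs ⊤ fun v w => (f v - f w) ^ 2]
  refine mul_le_mul_of_nonneg_left (le_of_eq ?_) (by positivity)
  refine Finset.sum_congr rfl fun v _ => Finset.sum_congr rfl fun w _ => ?_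
  by_cases h : v = w <;> simp [h]

open scoped Classical in
theorem completeBipartiteGraph_isRegularOfDegree (V : Type*) [Fintype V] :
    (completeBipartiteGraph V V).IsRegularOfDegree (Fintype.card V) := by
  rintro (v | v)
  · rw [← SimpleGraph.card_neighborFinset_eq_degree, ← Finset.card_univ,
      ← Finset.card_map (Function.Embedding.inr (α := V)) (s := Finset.univ)]
    refine congrArg Finset.card ?_
    ext (w | w) <;> simp
  · rw [← SimpleGraph.card_neighborFinset_eq_degree, ← Finset.card_univ,
      ← Finset.card_map (Function.Embedding.inl (β := V)) (s := Finset.univ)]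
    refine congrArg Finset.card ?_
    ext (w | w) <;> simp

/-- The two sides differ by a nonnegative multiple of the squared difference of the sums of `f` over
the two parts. -/
theorem hasPoincare_completeBipartiteGraph (V : Type*) [Fintype V] :
    HasPoincare (completeBipartiteGraph V V) (Fintype.card V) := by
  classical
  intro f
  have hE := energy_eq_of_regular (completeBipartiteGraph_isRegularOfDegree V) f
  have hcross : ∑ p ∈ adjPairs (completeBipartiteGraph V V), f (p 0) * f (p 1) =
      2 * ((∑ v, f (Sum.inl v)) * ∑ v, f (Sum.inr v)) := by
    rw [sum_adjPairs _ fun v w => f v * f w]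
    simp [completeBipartiteGraph, Fintype.sum_sum_type, ← Finset.mul_sum, ← Finset.sum_mul]
    ring
  have hcard : (Fintype.card (V ⊕ V) : ℝ) = 2 * Fintype.card V := by
    rw [Fintype.card_sum]
    push_cast
    ring
  rw [sum_sum_sub_sq, hE, hcross, hcard, Fintype.sum_sum_type f]
  nlinarith [mul_nonneg (Nat.cast_nonneg (α := ℝ) (Fintype.card V))
    (sq_nonneg ((∑ v, f (Sum.inl v)) - ∑ v, f (Sum.inr v)))]

theorem exists_pos_eventually_le_of_liminf_pos {u : ℕ → ℝ} (h : 0 < liminf u atTop) :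
    ∃ c > 0, ∀ᶠ n in atTop, c ≤ u n := by
  rw [liminf_eq] at h
  -- In `ℝ` the supremum of the empty set is `0`, so a positive liminf excludes that case.
  have hne : {a | ∀ᶠ n in atTop, a ≤ u n}.Nonempty := by
    by_contra hempty
    rw [Set.not_nonempty_iff_eq_empty.1 hempty, Real.sSup_empty] at h
    exact lt_irrefl _ h
  obtain ⟨c, hc, hc0⟩ := exists_lt_of_lt_csSup hne h
  exact ⟨c, hc0, hc⟩

end HomSum

end

theorem proposition3p3 (m : ℕ) (hm : 2 ≤ m) {Ω : Type*} [MeasurableSpace Ω] (P : Measure Ω)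
    [IsProbabilityMeasure P] :
    (∀ (V : ℕ → Type*) [∀ n, Fintype (V n)] [∀ n, DecidableEq (V n)]
      (G : ∀ n, SimpleGraph (V n)) [∀ n, DecidableRel (G n).Adj] (d : ℕ → ℕ),
      (∀ n, (G n).Connected) →
      (∀ n, 1 ≤ d n ∧ (G n).IsRegularOfDegree (d n)) →
      Tendsto (fun n => Fintype.card (V n)) atTop atTop →
      0 < liminf (fun n => HomSum.normalizedLaplaceEigenvalue (G n) 2) atTop →
      ∀ X : ∀ n, (Fin m → V n) → Ω → ℝ,
        (∀ n, HomSum.IsIIDStdGaussian P (X n)) →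
        HomSum.GeneratesIrreducibleCLT P X (fun n => HomSum.cartesianPower (G n) m)) ∧
    (∀ X : ∀ n : ℕ, (Fin m → Fin (n + 2)) → Ω → ℝ,
      (∀ n, HomSum.IsIIDStdGaussian P (X n)) →
      HomSum.GeneratesIrreducibleCLT P X
        (fun n => HomSum.cartesianPower (⊤ : SimpleGraph (Fin (n + 2))) m)) ∧
    (∀ X : ∀ n : ℕ, (Fin m → Fin (n + 1) ⊕ Fin (n + 1)) → Ω → ℝ,
      (∀ n, HomSum.IsIIDStdGaussian P (X n)) →
      HomSum.GeneratesIrreducibleCLT P X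
        (fun n => HomSum.cartesianPower
          (completeBipartiteGraph (Fin (n + 1)) (Fin (n + 1))) m)) := by
  classical
  refine ⟨?_, ?_, ?_⟩
  · intro V _ _ G _ d hconn hreg hcard hgap X hX
    have : ∀ n, Nonempty (V n) := fun n => (hconn n).nonempty
    obtain ⟨c, hc, hev⟩ := HomSum.exists_pos_eventually_le_of_liminf_pos hgap
    refine HomSum.generatesIrreducibleCLT_cartesianPower hm P G d (fun n => (hreg n).2)
      (fun n => (hreg n).1) hcard hc ?_ X hX
    filter_upwards [hev] with n hn
    refine (HomSum.hasPoincare_of_normalizedLaplaceEigenvalue_pos (hreg n).1 (hreg n).2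
      (hc.trans_le hn)).mono ?_
    gcongr
  · intro X hX
    refine HomSum.generatesIrreducibleCLT_cartesianPower hm P _ (fun n => n + 1)
      (fun n => by simpa using SimpleGraph.IsRegularOfDegree.top (V := Fin (n + 2)))
      (fun n => by omega) ?_ one_pos (Eventually.of_forall fun n => ?_) X hX
    · simpa using tendsto_add_atTop_nat 2
    -- The complete graph has Poincaré constant `n + 2`, above its degree `n + 1`, so `c = 1` works
    -- and no eigenvalue is computed.
    · refine (HomSum.hasPoincare_top _).mono ?_
      rw [Fintype.card_fin]
      push_cast
      linarith
  · intro X hX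
    refine HomSum.generatesIrreducibleCLT_cartesianPower hm P _ (fun n => n + 1)
      (fun n => by simpa using HomSum.completeBipartiteGraph_isRegularOfDegree (Fin (n + 1)))
      (fun n => by omega) ?_ one_pos (Eventually.of_forall fun n => ?_) X hX
    · refine tendsto_atTop_mono (fun n => ?_) tendsto_id
      simp only [Fintype.card_sum, Fintype.card_fin, id]
      omega
    · refine (HomSum.hasPoincare_completeBipartiteGraph _).mono ?_
      rw [Fintype.card_fin, one_mul]
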